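/- Regard the lattice $[0,1]$ (the closed unit interval of real numbers with its usual order) as a category, with exactly one morphism $a\to b$ if $a\le b$ and none otherwise. Then $[0,1]$ is accessible and predefinable, but it is not weakly definable. Here: - A category $\mathcal L$ is predefinable if it has all small products (including the empty one) and all colimits of small diagrams indexed by nonempty directed posets, and products distribute over directed colimits: for every small family of directed diagrams $\mathcal D_i\colon D_i\to\mathcal L$ $(i\in I)$ the canonical morphism $$\operatorname{colim}_{(d_i)\in\prod_{i\in I}D_i}\ \prod_{i\in I}\mathcal D_i(d_i)\ \longrightarrow\ \prod_{i\in I}\operatorname{colim}\mathcal D_i$$ is an isomorphism. - A category is weakly definable if it is equivalent to a full subcategory of some locally finitely presentable category $\mathcal K$ that is closed in $\mathcal K$ under small products (including the empty one) and directed colimits. -/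

import Mathlib

open CategoryTheory CategoryTheory.Limits

universe w v u v₁ u₁

namespace DefinableCategories

/-- A category `C` has directed colimits if it has colimits of all diagrams indexed by
(`w`-small, nonempty) directed posets. -/
class HasDirectedColimits (C : Type u) [Category.{v} C] : Prop where
  hasColimitsOfShape (J : Type w) [PartialOrder J] [IsDirectedOrder J] [Nonempty J] :
    HasColimitsOfShape J C

/-- The product of a family of posets, with the componentwise order. This is a copy of
`∀ i, J i`, which itself carries the product category structure `CategoryTheory.pi`. -/
def PiPoset {I : Type w} (J : I → Type w) : Type w := ∀ i, J i

instance {I : Type w} (J : I → Type w) [∀ i, PartialOrder (J i)] : PartialOrder (PiPoset J) :=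
  inferInstanceAs (PartialOrder (∀ i, J i))

/-- A product of directed posets, as a category, is the category of a directed poset, so
the colimit of a "product diagram" exists in any category with directed colimits. -/
theorem hasColimitsOfShape_pi (C : Type u) [Category.{v} C] [HasDirectedColimits.{w} C]
    {I : Type w} (J : I → Type w) [∀ i, PartialOrder (J i)] [∀ i, IsDirectedOrder (J i)]
    [∀ i, Nonempty (J i)] :
    HasColimitsOfShape (∀ i, J i) C := by
  have : IsDirectedOrder (PiPoset J) := ⟨fun a b => by
    choose f hf using fun i => exists_ge_ge (a i) (b i)
    exact ⟨f, fun i => (hf i).1, fun i => (hf i).2⟩⟩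
  have : Nonempty (PiPoset J) := inferInstanceAs (Nonempty (∀ i, J i))
  have h := HasDirectedColimits.hasColimitsOfShape (C := C) (PiPoset J)
  let F : PiPoset J ⥤ ∀ i, J i :=
    { obj := fun x => x
      map := fun f i => homOfLE (leOfHom f i)
      map_id := fun _ => by funext i; exact Subsingleton.elim _ _
      map_comp := fun _ _ => by funext i; exact Subsingleton.elim _ _ }
  have hF : F.Full := ⟨fun g =>
    ⟨homOfLE fun i => leOfHom (g i), by funext i; exact Subsingleton.elim _ _⟩⟩
  have hF' : F.Faithful := ⟨fun _ => Subsingleton.elim _ _⟩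
  have hF'' : F.EssSurj := ⟨fun y => ⟨y, ⟨Iso.refl _⟩⟩⟩
  have : F.IsEquivalence := { }
  exact hasColimitsOfShape_of_equivalence F.asEquivalence

/-- A category is predefinable if it has (small) products and directed colimits and products
distribute over directed colimits: for every small family `F i : J i ⥤ C` of directed diagrams,
with product diagram `pointwiseProduct F : (∀ i, J i) ⥤ C`, `(d i) ↦ ∏ᶜ fun i => (F i).obj (d i)`,
the canonical morphism `colim (pointwiseProduct F) ⟶ ∏ᶜ fun i => colim (F i)` is an
isomorphism. -/
structure IsPredefinable (C : Type u) [Category.{v} C] : Prop where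
  hasProducts : HasProducts.{w} C
  hasDirectedColimits : HasDirectedColimits.{w} C
  isIso_canonicalMorphism (I : Type w) (J : I → Type w) [∀ i, PartialOrder (J i)]
    [∀ i, IsDirectedOrder (J i)] [∀ i, Nonempty (J i)] (F : ∀ i, J i ⥤ C) :
    haveI : ∀ i, HasColimitsOfShape (J i) C := fun i =>
      HasDirectedColimits.hasColimitsOfShape (J i)
    haveI : HasColimitsOfShape (∀ i, J i) C := hasColimitsOfShape_pi C J
    IsIso (colimitPointwiseProductToProductColimit F)

/-- A full subcategory (given by the property `P` of its objects) of a category `K` is closed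
under (small) products, including the empty product, and under directed colimits, both formed
in `K`. Applied to a locally finitely presentable `K`, this says that the full subcategory is
weakly definable. -/
structure IsClosedUnderProductsAndDirectedColimits {K : Type u} [Category.{v} K]
    (P : ObjectProperty K) : Prop where
  products (I : Type w) : P.IsClosedUnderLimitsOfShape (Discrete I)
  directedColimits (J : Type w) [PartialOrder J] [IsDirectedOrder J] [Nonempty J] :
    P.IsClosedUnderColimitsOfShape J

/-- A category `C` is weakly definable if it is equivalent to a full subcategory of a locally
finitely presentable category `K` which is closed in `K` under products and directed colimits. -/
def IsWeaklyDefinable (C : Type u₁) [Category.{v₁} C] : Prop :=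
  ∃ (K : Type u) (_ : Category.{v} K) (P : ObjectProperty K),
    IsLocallyFinitelyPresentable.{w} K ∧
    IsClosedUnderProductsAndDirectedColimits.{w} P ∧
    Nonempty (C ≌ P.FullSubcategory)

end DefinableCategories

/-!
In a small preorder every sufficiently filtered diagram is eventually constant, so all objects are
presentable and the preorder is accessible. In a complete lattice, distributivity of products over
directed colimits is a case of complete distributivity.

If a small complete lattice `α` is weakly definable, embed it in a locally finitely presentable
category `K` by a functor `G` preserving products and directed colimits. For each `A : K` the
infimum of all `x` with a morphism `A ⟶ G x` again has this property, so `G` has a left adjoint.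
Since `G` is also finitary and fully faithful, `α` is locally finitely presentable, that is, an
algebraic lattice. But in a densely ordered chain only `⊥` is compact.
-/

namespace DefinableCategories

section Completeness

/-- A category with a small dense subcategory embeds reflectively in a presheaf category. -/
theorem hasLimitsOfSize_of_isDense {D : Type w} [SmallCategory D] {E : Type u} [Category.{w} E]
    [HasColimitsOfSize.{w, w} E] (A : D ⥤ E) [A.IsDense] : HasLimitsOfSize.{w, w} E := by
  have (X : Dᵒᵖ ⥤ Type w) :
      HasColimitsOfShape (CostructuredArrow (uliftYoneda.{w} (C := D)) X) E :=
    hasColimitsOfShape_of_equivalence (equivSmallModel.{w} _).symm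
  have : (uliftYoneda.{w} (C := D)).HasPointwiseLeftKanExtension A := fun X => by
    unfold Functor.HasPointwiseLeftKanExtensionAt
    infer_instance
  let : Reflective (Presheaf.restrictedULiftYoneda.{w} A) :=
    ⟨_, Presheaf.uliftYonedaAdjunction.{w} _
      ((uliftYoneda.{w} (C := D)).leftKanExtensionUnit A)⟩
  exact hasLimits_of_reflective (Presheaf.restrictedULiftYoneda.{w} A)

theorem hasLimitsOfSize_of_isCardinalLocallyPresentable (K : Type u) [Category.{v} K]
    (κ : Cardinal.{w}) [Fact κ.IsRegular] [IsCardinalLocallyPresentable K κ] :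
    HasLimitsOfSize.{w, w} K := by
  let P := isCardinalPresentable K κ
  let A := (equivSmallModel.{w} P.FullSubcategory).inverse ⋙ P.ι ⋙ ShrinkHoms.functor.{w} K
  have : HasColimitsOfSize.{w, w} (ShrinkHoms.{u} K) :=
    Adjunction.has_colimits_of_equivalence (ShrinkHoms.inverse.{w} K)
  have := hasLimitsOfSize_of_isDense A
  exact Adjunction.has_limits_of_equivalence (ShrinkHoms.functor.{w} K)

end Completeness

section Accessible

theorem preservesColimit_of_isEventuallyConstantFrom {J C D : Type*} [Category* J] [Category* C]
    [Category* D] [IsFiltered J] {F : J ⥤ C} {j : J} (h : F.IsEventuallyConstantFrom j)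
    (G : C ⥤ D) : PreservesColimit F G where
  preserves {c} hc := by
    have : IsIso (c.ι.app j) := h.isIso_ι_of_isColimit hc
    have : IsIso ((G.mapCocone c).ι.app j) := inferInstanceAs (IsIso (G.map (c.ι.app j)))
    have hG : (F ⋙ G).IsEventuallyConstantFrom j := fun _ f =>
      have := h f
      inferInstanceAs (IsIso (G.map (F.map f)))
    exact ⟨hG.isColimitOfIsIso _⟩

variable {α : Type u} [Preorder α]

theorem exists_isEventuallyConstantFrom {κ : Cardinal.{w}} [Fact κ.IsRegular]
    (hα : HasCardinalLT α κ) {J : Type*} [Category* J] [IsCardinalFiltered J κ] (F : J ⥤ α) :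
    ∃ j, F.IsEventuallyConstantFrom j := by
  have hrange : HasCardinalLT (Set.range F.obj) κ := hα.of_injective _ Subtype.val_injective
  choose index obj_index using fun y : Set.range F.obj => y.2
  let j₀ := IsCardinalFiltered.max index hrange
  have obj_le (j : J) : F.obj j ≤ F.obj j₀ :=
    (obj_index ⟨F.obj j, j, rfl⟩).ge.trans
      (leOfHom (F.map (IsCardinalFiltered.toMax index hrange _)))
  exact ⟨j₀, fun j _ => ⟨homOfLE (obj_le j), Subsingleton.elim _ _, Subsingleton.elim _ _⟩⟩

theorem isCardinalPresentable_of_hasCardinalLT {κ : Cardinal.{w}} [Fact κ.IsRegular]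
    (hα : HasCardinalLT α κ) (x : α) : IsCardinalPresentable x κ where
  preservesColimitOfShape J _ _ :=
    ⟨fun {F} =>
      have := isFiltered_of_isCardinalFiltered J κ
      have ⟨_, h⟩ := exists_isEventuallyConstantFrom hα F
      preservesColimit_of_isEventuallyConstantFrom h _⟩

theorem hasCardinalFilteredColimits_of_hasCardinalLT {κ : Cardinal.{w}} [Fact κ.IsRegular]
    (hα : HasCardinalLT α κ) : HasCardinalFilteredColimits.{w} α κ where
  hasColimitsOfShape J _ _ :=
    ⟨fun F =>
      have := isFiltered_of_isCardinalFiltered J κ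
      have ⟨_, h⟩ := exists_isEventuallyConstantFrom hα F
      h.hasColimit⟩

theorem isAccessibleCategory_of_small [Small.{w} α] : IsAccessibleCategory.{w} α := by
  obtain ⟨κ, hκ, hα⟩ := HasCardinalLT.exists_regular_cardinal.{w} α
  have : Fact κ.IsRegular := ⟨hκ⟩
  have : EssentiallySmall.{w} α := essentiallySmall_of_small_of_locallySmall _
  have hgen : (⊤ : ObjectProperty α).IsCardinalFilteredGenerator κ :=
    { le_isCardinalPresentable := fun x _ => isCardinalPresentable_of_hasCardinalLT hα x
      exists_colimitsOfShape := fun x =>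
        ⟨PUnit, inferInstance, isCardinalFiltered_of_hasTerminal _ _,
          ⟨{ toColimitPresentation := .self x, prop_diag_obj := fun _ => trivial }⟩⟩ }
  exact ⟨κ, ⟨hκ⟩,
    { toHasCardinalFilteredGenerator := hgen.hasCardinalFilteredGenerator
      toHasCardinalFilteredColimits := hasCardinalFilteredColimits_of_hasCardinalLT hα }⟩

end Accessible

theorem isPredefinable_of_completelyDistribLattice {α : Type u} [CompletelyDistribLattice α] :
    IsPredefinable.{w} α where
  hasProducts _ := inferInstance
  hasDirectedColimits := ⟨fun _ _ _ _ => inferInstance⟩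
  isIso_canonicalMorphism I J _ _ _ F := by
    have prod_le_colim : (∏ᶜ fun i => colimit (F i)) ≤ colimit (pointwiseProduct F) :=
      calc (∏ᶜ fun i => colimit (F i)) ≤ ⨅ i, ⨆ j, (F i).obj j :=
            le_iInf fun i => (leOfHom (Pi.π _ i)).trans
              (CompleteLattice.colimit_eq_iSup (F i)).le
        _ = ⨆ d : ∀ i, J i, ⨅ i, (F i).obj (d i) := iInf_iSup_eq
        _ ≤ colimit (pointwiseProduct F) := iSup_le fun d =>
            (leOfHom (Pi.lift fun i => homOfLE (iInf_le _ i))).trans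
              (leOfHom (colimit.ι (pointwiseProduct F) d))
    exact ⟨homOfLE prod_le_colim, Subsingleton.elim _ _, Subsingleton.elim _ _⟩

section Reflection

variable {α : Type u₁} {K : Type u} [Category.{v} K]

-- In a preorder `x` is the product `x × x`, with both projections equal to `𝟙 x`.
theorem subsingleton_hom_obj_of_preservesBinaryProducts [Preorder α] (G : α ⥤ K)
    [PreservesLimitsOfShape (Discrete WalkingPair) G] (A : K) (x : α) :
    Subsingleton (A ⟶ G.obj x) where
  allEq f g := by
    have isLimit_diag : IsLimit (BinaryFan.mk (𝟙 x) (𝟙 x)) :=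
      BinaryFan.isLimitMk (fun s => s.fst) (fun _ => Subsingleton.elim _ _)
        (fun _ => Subsingleton.elim _ _) (fun _ _ _ _ => Subsingleton.elim _ _)
    obtain ⟨l, hf, hg⟩ :=
      BinaryFan.IsLimit.lift' (mapIsLimitOfPreservesOfIsLimit G _ _ isLimit_diag) f g
    exact hf.symm.trans hg

theorem nonempty_hom_obj_iInf [CompleteLattice α] {ι : Type*} (G : α ⥤ K)
    [PreservesLimitsOfShape (Discrete ι) G] {A : K} {x : ι → α}
    (h : ∀ i, Nonempty (A ⟶ G.obj (x i))) : Nonempty (A ⟶ G.obj (⨅ i, x i)) :=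
  ⟨(isLimitOfPreserves G (Preorder.isLimitIInf x)).lift
    ⟨A, Discrete.natTrans fun i => (h i.as).some⟩⟩

theorem isRightAdjoint_of_preservesProducts [CompleteLattice α] [Small.{w} α] (G : α ⥤ K)
    [∀ I : Type w, PreservesLimitsOfShape (Discrete I) G] : G.IsRightAdjoint := by
  have preservesSmallProducts (I : Type u₁) [Small.{w} I] :
      PreservesLimitsOfShape (Discrete I) G :=
    preservesLimitsOfShape_of_equiv (Discrete.equivalence (equivShrink.{w} I).symm) G
  have : PreservesLimitsOfShape (Discrete WalkingPair) G :=
    preservesLimitsOfShape_of_equiv (Discrete.equivalence (equivShrink.{w} WalkingPair).symm) G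
  have subsingleton_hom := subsingleton_hom_obj_of_preservesBinaryProducts G
  let reflection (A : K) : α := ⨅ x : {x | Nonempty (A ⟶ G.obj x)}, x
  have unit (A : K) : Nonempty (A ⟶ G.obj (reflection A)) := nonempty_hom_obj_iInf G fun x => x.2
  exact (Adjunction.adjunctionOfEquivLeft
    (fun A x => equivOfSubsingletonOfSubsingleton (fun f => (unit A).some ≫ G.map f)
      fun f => homOfLE (iInf_le (fun x : {x | Nonempty (A ⟶ G.obj x)} => (x : α)) ⟨x, ⟨f⟩⟩))
    fun _ _ _ _ _ => Subsingleton.elim _ _).isRightAdjoint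

end Reflection

section FinitelyPresentable

attribute [local instance] Cardinal.fact_isRegular_aleph0

theorem isFinitelyAccessible_of_preservesDirectedColimits {C D : Type*} [Category* C]
    [Category* D] (G : C ⥤ D)
    (hG : ∀ (J : Type w) [PartialOrder J] [IsDirectedOrder J] [Nonempty J],
      PreservesColimitsOfShape J G) : G.IsFinitelyAccessible.{w} where
  preservesColimitOfShape J _ _ := by
    have := isFiltered_of_isCardinalFiltered J Cardinal.aleph0.{w}
    obtain ⟨J', _, _, _, F, _⟩ := IsFiltered.exists_directed J
    have := hG J'
    exact Functor.Final.preservesColimitsOfShape_of_final F G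

theorem isLocallyFinitelyPresentable_of_isWeaklyDefinable {α : Type u₁} [CompleteLattice α]
    [Small.{w} α] (h : IsWeaklyDefinable.{w, v, u} α) : IsLocallyFinitelyPresentable.{w} α := by
  obtain ⟨K, _, P, _, hP, ⟨e⟩⟩ := h
  have := hasLimitsOfSize_of_isCardinalLocallyPresentable K Cardinal.aleph0.{w}
  let G := e.functor ⋙ P.ι
  have (I : Type w) : PreservesLimitsOfShape (Discrete I) G := by
    have := hP.products I
    infer_instance
  have : G.IsFinitelyAccessible.{w} :=
    isFinitelyAccessible_of_preservesDirectedColimits G fun J _ _ _ => by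
      have := hP.directedColimits J
      infer_instance
  have : G.IsRightAdjoint := isRightAdjoint_of_preservesProducts.{w} G
  exact (Adjunction.ofIsRightAdjoint G).isCardinalLocallyPresentable Cardinal.aleph0.{w}

theorem isCompactElement_of_isFinitelyPresentable {α : Type u} [PartialOrder α] [Small.{w} α]
    (x : α) [IsFinitelyPresentable.{w} x] : IsCompactElement x := by
  intro s u hne hdir hlub hxu
  have : Nonempty s := hne.to_subtype
  have : IsDirectedOrder s := directedOn_iff_isDirectedOrder.mp hdir
  have : IsCardinalFiltered s Cardinal.aleph0.{w} :=
    (isCardinalFiltered_aleph0_iff.{w} s).mpr inferInstance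
  have : EssentiallySmall.{w} s := essentiallySmall_of_small_of_locallySmall _
  let F : s ⥤ α := Monotone.functor (f := Subtype.val) fun _ _ h => h
  have hF : IsLUB (Set.range F.obj) u := (Subtype.range_coe (s := s)).symm ▸ hlub
  obtain ⟨y, f, -⟩ := IsCardinalPresentable.exists_hom_of_isColimit Cardinal.aleph0.{w}
    (Preorder.colimitCoconeOfIsLUB F hF).isColimit (homOfLE hxu)
  exact ⟨y, y.2, leOfHom f⟩

theorem isCompactlyGenerated_of_isLocallyFinitelyPresentable {α : Type u} [CompleteLattice α]
    [Small.{w} α] [IsLocallyFinitelyPresentable.{w} α] : IsCompactlyGenerated α where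
  exists_sSup_eq x := by
    obtain ⟨P, _, hP⟩ := HasCardinalFilteredGenerator.exists_generator α Cardinal.aleph0.{w}
    obtain ⟨J, _, _, ⟨p⟩⟩ := hP.exists_colimitsOfShape x
    refine ⟨Set.range p.diag.obj, ?_, (Preorder.isLUB_of_isColimit _ p.isColimit).sSup_eq⟩
    rintro _ ⟨j, rfl⟩
    have : IsFinitelyPresentable.{w} (p.diag.obj j) :=
      hP.le_isCardinalPresentable _ (p.prop_diag_obj j)
    exact isCompactElement_of_isFinitelyPresentable.{w} _

end FinitelyPresentable

section DenselyOrdered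

variable {α : Type*} [CompleteLinearOrder α] [DenselyOrdered α]

theorem eq_bot_of_isCompactElement {k : α} (hk : IsCompactElement k) : k = ⊥ := by
  by_contra hne
  have hlt : sSup (Set.Iio k) < k :=
    CompleteLattice.IsCompactElement.directed_sSup_lt_of_lt hk ⟨⊥, bot_lt_iff_ne_bot.mpr hne⟩
      (Std.Total.directedOn _) fun _ hx => hx
  obtain ⟨y, hy, hyk⟩ := exists_between hlt
  exact hy.not_ge (le_sSup hyk)

theorem not_isCompactlyGenerated_of_denselyOrdered [Nontrivial α] :
    ¬ IsCompactlyGenerated α := fun _ =>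
  bot_ne_top (α := α) <| eq_top_iff.mpr <|
    calc (⊤ : α) = sSup {k | IsCompactElement k} := sSup_compact_eq_top.symm
      _ ≤ ⊥ := sSup_le fun _ hk => (eq_bot_of_isCompactElement hk).le

end DenselyOrdered

end DefinableCategories

theorem mainTheorem12_general (α : Type u₁) [CompleteLinearOrder α] [DenselyOrdered α]
    [Nontrivial α] [Small.{w} α] :
    IsAccessibleCategory.{w} α ∧
    DefinableCategories.IsPredefinable.{w} α ∧
    ¬ DefinableCategories.IsWeaklyDefinable.{w, v, u} α := by
  refine ⟨DefinableCategories.isAccessibleCategory_of_small,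
    DefinableCategories.isPredefinable_of_completelyDistribLattice, fun h => ?_⟩
  have := DefinableCategories.isLocallyFinitelyPresentable_of_isWeaklyDefinable h
  exact DefinableCategories.not_isCompactlyGenerated_of_denselyOrdered
    (DefinableCategories.isCompactlyGenerated_of_isLocallyFinitelyPresentable.{w} (α := α))

theorem mainTheorem12 :
    IsAccessibleCategory.{w} (Set.Icc (0 : ℝ) 1) ∧
    DefinableCategories.IsPredefinable.{w} (Set.Icc (0 : ℝ) 1) ∧
    ¬ DefinableCategories.IsWeaklyDefinable.{w, v, u} (Set.Icc (0 : ℝ) 1) :=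
  mainTheorem12_general _
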